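/- Let $H_0 = J_0 + iY_0$ and $H_1 = J_1 + iY_1$ be the Hankel functions of the first kind of orders zero and one. Let $r_1 > 0$ and let $A_j, B_j \in \mathbb{C}$ for $j \in \mathbb{N} = \{0, 1, 2, \dots\}$. Suppose that the series $\sum_{j=0}^{\infty} A_j r^{-j}$ and $\sum_{j=0}^{\infty} B_j r^{-j}$ both converge absolutely and uniformly for $r \ge r_1$, and that $$H_0(r)\sum_{j=0}^{\infty} \frac{A_j}{r^{j}} + H_1(r)\sum_{j=0}^{\infty} \frac{B_j}{r^{j}} = 0 \qquad \text{for all real } r \ge r_1.$$ Then $A_j = B_j = 0$ for all $j \in \mathbb{N}$. -/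

import Mathlib

open Filter Set

/-- The Bessel function of the first kind `J_n` of integer order `n ≥ 0`:
`J_n(z) = (z/2)^n ∑_k (-z²/4)^k / (k! (n+k)!)` (the series converges for every complex `z`). -/
noncomputable def besselJ (n : ℕ) (z : ℂ) : ℂ :=
  (z / 2) ^ n *
    ∑' k : ℕ, (-(z ^ 2) / 4) ^ k / ((k.factorial : ℂ) * ((n + k).factorial : ℂ))

/-- The value `ψ(m + 1) = 1 + 1/2 + ⋯ + 1/m - γ` of the digamma function,
where `γ` is the Euler-Mascheroni constant. -/
noncomputable def digammaSucc (m : ℕ) : ℂ :=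
  ((harmonic m : ℚ) : ℂ) - (Real.eulerMascheroniConstant : ℂ)

/-- The Bessel function of the second kind (Neumann function) `Y_n` of integer order `n ≥ 0`,
with the principal branch of the logarithm:
`Y_n(z) = -((z/2)^(-n)/π) ∑_{k<n} ((n-k-1)!/k!) (z²/4)^k + (2/π) log(z/2) J_n(z)
  - ((z/2)^n/π) ∑_k (ψ(k+1) + ψ(n+k+1)) (-z²/4)^k / (k! (n+k)!)`.
The subtraction `n - k - 1` does not truncate, since `k < n` in the finite sum. -/
noncomputable def besselY (n : ℕ) (z : ℂ) : ℂ :=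
  -((z / 2) ^ n)⁻¹ / (Real.pi : ℂ) *
      ∑ k ∈ Finset.range n,
        ((n - k - 1).factorial : ℂ) / (k.factorial : ℂ) * (z ^ 2 / 4) ^ k
    + 2 / (Real.pi : ℂ) * Complex.log (z / 2) * besselJ n z
    - (z / 2) ^ n / (Real.pi : ℂ) *
      ∑' k : ℕ, (digammaSucc k + digammaSucc (n + k)) * (-(z ^ 2) / 4) ^ k /
        ((k.factorial : ℂ) * ((n + k).factorial : ℂ))

/-- The Hankel function of the first kind `H_n = J_n + i Y_n` of integer order `n ≥ 0`. -/
noncomputable def hankelH (n : ℕ) (z : ℂ) : ℂ :=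
  besselJ n z + Complex.I * besselY n z

/-- The series `∑_j C_j r^(-j)` converges absolutely at every `r ≥ r₁`, and its partial sums
converge uniformly on `[r₁, ∞)` to its sum. -/
def ConvergesAbsolutelyAndUniformly (C : ℕ → ℂ) (r₁ : ℝ) : Prop :=
  (∀ r : ℝ, r₁ ≤ r → Summable fun j : ℕ => ‖C j / (r : ℂ) ^ j‖) ∧
  TendstoUniformlyOn (fun (N : ℕ) (r : ℝ) => ∑ j ∈ Finset.range N, C j / (r : ℂ) ^ j)
    (fun r : ℝ => ∑' j : ℕ, C j / (r : ℂ) ^ j) atTop (Ici r₁)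

open Topology

/-! The monodromy of the logarithm separates the relation into two. In `z * H_n(z)` the only
multivalued term is `(2i/π) log(z/2) * z * J_n(z)`; the rest is entire. The series in `1/z` are
analytic and single-valued for `|z| > r₁`, so with `z = e^w` the relation reads `(p + q w) f(w) +
g(w) = 0`, where `f`, `g` are `2πi`-periodic on a half-plane. A shift by `2πi` forces `f = g = 0`
(`eq_zero_of_linear_mul_add_eq_zero`).

This gives a homogeneous 2×2 linear system for the two sums. Its determinant `besselDet` is entire
and nonzero at `0`, hence not identically zero on any ray. Both sums thus vanish on an interval, and
the identity theorem in the variable `1/r` kills all coefficients. -/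

theorem hasFPowerSeriesOnBall_tsum {c : ℕ → ℂ} {R : ℝ} (hR : 0 < R)
    (hc : Summable fun k => ‖c k‖ * R ^ k) :
    HasFPowerSeriesOnBall (fun z : ℂ => ∑' k, c k * z ^ k)
      (FormalMultilinearSeries.ofScalars ℂ c) 0 (ENNReal.ofReal R) := by
  have hle : ENNReal.ofReal R ≤ (FormalMultilinearSeries.ofScalars ℂ c).radius := by
    refine FormalMultilinearSeries.le_radius_of_summable_norm _ ?_
    simpa [FormalMultilinearSeries.ofScalars_norm, Real.coe_toNNReal _ hR.le] using hc
  have hpos : 0 < ENNReal.ofReal R := ENNReal.ofReal_pos.2 hR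
  have h := ((FormalMultilinearSeries.ofScalars ℂ c).hasFPowerSeriesOnBall
    (hpos.trans_le hle)).mono hpos hle
  refine h.congr fun z _ => ?_
  simp [FormalMultilinearSeries.sum, mul_comm]

theorem analyticAt_tsum {c : ℕ → ℂ} {R : ℝ} (hR : 0 < R)
    (hc : Summable fun k => ‖c k‖ * R ^ k) {z : ℂ} (hz : ‖z‖ < R) :
    AnalyticAt ℂ (fun z : ℂ => ∑' k, c k * z ^ k) z := by
  refine (hasFPowerSeriesOnBall_tsum hR hc).analyticAt_of_mem ?_
  rw [Metric.mem_eball, edist_zero_right, ← ofReal_norm]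
  exact (ENNReal.ofReal_lt_ofReal_iff hR).2 hz

theorem analyticAt_tsum_of_le {c : ℕ → ℂ} {C : ℝ} (hc : ∀ k, ‖c k‖ ≤ C / k.factorial) (z : ℂ) :
    AnalyticAt ℂ (fun z : ℂ => ∑' k, c k * z ^ k) z := by
  have hR : 0 < ‖z‖ + 1 := by positivity
  refine analyticAt_tsum hR ?_ (lt_add_one _)
  refine Summable.of_nonneg_of_le (fun k => by positivity) (fun k => ?_)
    ((Real.summable_pow_div_factorial (‖z‖ + 1)).mul_left C)
  calc ‖c k‖ * (‖z‖ + 1) ^ k ≤ C / k.factorial * (‖z‖ + 1) ^ k := by gcongr; exact hc k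
    _ = _ := by ring

theorem frequently_eq_zero_of_ofReal {f : ℂ → ℂ} {a x : ℝ} (hax : a < x)
    (hf : ∀ t : ℝ, a < t → f t = 0) : ∃ᶠ z in 𝓝[≠] (x : ℂ), f z = 0 := by
  have ht : Tendsto (fun t : ℝ => (t : ℂ)) (𝓝[≠] x) (𝓝[≠] (x : ℂ)) := by
    refine tendsto_nhdsWithin_of_tendsto_nhds_of_eventually_within _
      (Complex.continuous_ofReal.continuousAt.tendsto.mono_left nhdsWithin_le_nhds) ?_
    filter_upwards [self_mem_nhdsWithin] with t ht
    simpa using ht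
  refine ht.frequently (Eventually.frequently ?_)
  filter_upwards [nhdsWithin_le_nhds (Ioi_mem_nhds hax)] with t ht using hf t ht

theorem isPreconnected_re_gt (a : ℝ) : IsPreconnected {w : ℂ | a < w.re} :=
  (convex_halfSpace_re_gt a).isPreconnected

/-- The identity theorem extends the relation from the ray to the half-plane, which `w ↦ w + 2πi`
preserves. Subtracting the relation at `w` from that at `w + 2πi` leaves `2πi q f(w) = 0`. -/
theorem eq_zero_of_linear_mul_add_eq_zero {f g : ℂ → ℂ} {a : ℝ} {p q : ℂ} (hq : q ≠ 0)
    (hf : ∀ w : ℂ, a < w.re → AnalyticAt ℂ f w) (hg : ∀ w : ℂ, a < w.re → AnalyticAt ℂ g w)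
    (hfp : Function.Periodic f (2 * Real.pi * Complex.I))
    (hgp : Function.Periodic g (2 * Real.pi * Complex.I))
    (h : ∀ t : ℝ, a < t → (p + q * t) * f t + g t = 0) {w : ℂ} (hw : a < w.re) :
    f w = 0 ∧ g w = 0 := by
  have hz : EqOn (fun w => (p + q * w) * f w + g w) 0 {w : ℂ | a < w.re} := by
    refine AnalyticOnNhd.eqOn_zero_of_preconnected_of_frequently_eq_zero (z₀ := ((a + 1 : ℝ) : ℂ))
      (fun w hw => ?_) (isPreconnected_re_gt a) (by simp)
      (frequently_eq_zero_of_ofReal (lt_add_one a) h)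
    have := hf w hw
    have := hg w hw
    fun_prop
  have h1 : (p + q * w) * f w + g w = 0 := hz hw
  have h2 : (p + q * (w + 2 * Real.pi * Complex.I)) * f (w + 2 * Real.pi * Complex.I)
      + g (w + 2 * Real.pi * Complex.I) = 0 := hz (by simpa using hw)
  rw [hfp w, hgp w] at h2
  have h3 : q * (2 * Real.pi * Complex.I) * f w = 0 := by linear_combination h2 - h1
  have hfw : f w = 0 :=
    (mul_eq_zero.1 h3).resolve_left (mul_ne_zero hq Complex.two_pi_I_ne_zero)
  exact ⟨hfw, by simpa [hfw] using h1⟩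

/-! ### Analyticity of the Bessel and Neumann series -/

theorem norm_digammaSucc_le (m : ℕ) : ‖digammaSucc m‖ ≤ m + 1 := by
  have hh : ((harmonic m : ℚ) : ℝ) ≤ m := by
    have : harmonic m ≤ m := by
      unfold harmonic
      calc ∑ i ∈ Finset.range m, ((i + 1 : ℕ) : ℚ)⁻¹ ≤ ∑ i ∈ Finset.range m, 1 := by
            refine Finset.sum_le_sum fun i _ => inv_le_one_of_one_le₀ ?_
            exact_mod_cast Nat.succ_pos i
        _ = m := by simp
    exact_mod_cast this
  have h0 : 0 ≤ ((harmonic m : ℚ) : ℝ) := by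
    have : 0 ≤ harmonic m := by unfold harmonic; positivity
    exact_mod_cast this
  have hg := Real.eulerMascheroniConstant_lt_two_thirds
  have hg' := Real.one_half_lt_eulerMascheroniConstant
  have he : digammaSucc m
      = (((harmonic m : ℚ) : ℝ) - Real.eulerMascheroniConstant : ℝ) := by
    simp [digammaSucc]
  rw [he, Complex.norm_real, Real.norm_eq_abs, abs_le]
  constructor <;> linarith

theorem analyticAt_besselJ (n : ℕ) (z : ℂ) : AnalyticAt ℂ (besselJ n) z := by
  have h := analyticAt_tsum_of_le (C := 1)
    (c := fun k : ℕ => ((k.factorial : ℂ) * ((n + k).factorial : ℂ))⁻¹) (fun k => by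
      have h1 : (1 : ℝ) ≤ (n + k).factorial := by exact_mod_cast (n + k).factorial_pos
      have h2 : (0 : ℝ) < k.factorial := by exact_mod_cast k.factorial_pos
      rw [norm_inv, norm_mul, Complex.norm_natCast, Complex.norm_natCast, one_div]
      gcongr
      nlinarith) (-(z ^ 2) / 4)
  have h' := AnalyticAt.fun_comp (f := fun z : ℂ => -(z ^ 2) / 4) h (by fun_prop)
  have he : besselJ n = fun z => (z / 2) ^ n * ∑' k : ℕ,
      ((k.factorial : ℂ) * ((n + k).factorial : ℂ))⁻¹ * (-(z ^ 2) / 4) ^ k := by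
    funext z
    simp only [besselJ, div_eq_inv_mul]
  rw [he]
  exact AnalyticAt.mul (by fun_prop) h'

/-- The power series in the definition of `Y_n`. -/
noncomputable def neumannSeries (n : ℕ) (z : ℂ) : ℂ :=
  ∑' k : ℕ, (digammaSucc k + digammaSucc (n + k)) * (-(z ^ 2) / 4) ^ k /
    ((k.factorial : ℂ) * ((n + k).factorial : ℂ))

theorem analyticAt_neumannSeries (n : ℕ) (z : ℂ) : AnalyticAt ℂ (neumannSeries n) z := by
  have h := analyticAt_tsum_of_le (C := 4)
    (c := fun k : ℕ => (digammaSucc k + digammaSucc (n + k)) /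
      ((k.factorial : ℂ) * ((n + k).factorial : ℂ))) (fun k => by
      have h2 : (0 : ℝ) < k.factorial := by exact_mod_cast k.factorial_pos
      have h1 : (1 : ℝ) ≤ (n + k).factorial := by exact_mod_cast (n + k).factorial_pos
      have h3 : ((n : ℝ) + k) ≤ (n + k).factorial := by
        exact_mod_cast (n + k).self_le_factorial
      -- The norm is at most `(k + 1) + (n + k + 1) ≤ 2(n + k) + 2`, and both `n + k` and `1` are at
      -- most `(n + k)!`; hence the constant 4.
      have h4 : ‖digammaSucc k + digammaSucc (n + k)‖ ≤ 4 * (n + k).factorial := by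
        have := norm_add_le (digammaSucc k) (digammaSucc (n + k))
        have := norm_digammaSucc_le k
        have := norm_digammaSucc_le (n + k)
        push_cast at this
        have : (0 : ℝ) ≤ n := n.cast_nonneg
        linarith
      rw [norm_div, norm_mul, Complex.norm_natCast, Complex.norm_natCast,
        div_le_div_iff₀ (by positivity) h2]
      nlinarith) (-(z ^ 2) / 4)
  have h' := AnalyticAt.fun_comp (f := fun z : ℂ => -(z ^ 2) / 4) h (by fun_prop)
  have he : neumannSeries n = fun z => ∑' k : ℕ, (digammaSucc k + digammaSucc (n + k)) /
      ((k.factorial : ℂ) * ((n + k).factorial : ℂ)) * (-(z ^ 2) / 4) ^ k := by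
    funext z
    simp only [neumannSeries, div_mul_eq_mul_div]
  rw [he]
  exact h'

/-- The single-valued part of `z * H_0(z)`, obtained by removing the logarithmic term. -/
noncomputable def regularPartZero (z : ℂ) : ℂ :=
  -Complex.I * z / Real.pi * neumannSeries 0 z

/-- The single-valued part of `z * H_1(z)`, obtained by removing the logarithmic term. -/
noncomputable def regularPartOne (z : ℂ) : ℂ :=
  -Complex.I / Real.pi * (2 + z ^ 2 / 2 * neumannSeries 1 z)

theorem mul_hankelH_zero (z : ℂ) :
    z * hankelH 0 z = (1 + 2 * Complex.I / Real.pi * Complex.log (z / 2)) * (z * besselJ 0 z)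
      + regularPartZero z := by
  simp only [hankelH, besselY, regularPartZero, neumannSeries, Finset.range_zero,
    Finset.sum_empty, pow_zero]
  ring

theorem mul_hankelH_one {z : ℂ} (hz : z ≠ 0) :
    z * hankelH 1 z = (1 + 2 * Complex.I / Real.pi * Complex.log (z / 2)) * (z * besselJ 1 z)
      + regularPartOne z := by
  simp only [hankelH, besselY, regularPartOne, neumannSeries, Finset.range_one,
    Finset.sum_singleton, pow_zero, pow_one]
  have hp : (Real.pi : ℂ) ≠ 0 := by exact_mod_cast Real.pi_ne_zero
  simp
  field_simp
  ring

/-- `z` times the determinant of the Bessel functions `J_0`, `J_1` against the single-valued parts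
of `H_0`, `H_1`. -/
noncomputable def besselDet (z : ℂ) : ℂ :=
  besselJ 0 z * regularPartOne z - besselJ 1 z * regularPartZero z

theorem analyticAt_regularPartZero (z : ℂ) : AnalyticAt ℂ regularPartZero z := by
  have := analyticAt_neumannSeries 0 z
  unfold regularPartZero
  fun_prop

theorem analyticAt_regularPartOne (z : ℂ) : AnalyticAt ℂ regularPartOne z := by
  have := analyticAt_neumannSeries 1 z
  unfold regularPartOne
  fun_prop

theorem analyticAt_besselDet (z : ℂ) : AnalyticAt ℂ besselDet z := by
  have := analyticAt_besselJ 0 z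
  have := analyticAt_besselJ 1 z
  have := analyticAt_regularPartZero z
  have := analyticAt_regularPartOne z
  unfold besselDet
  fun_prop

theorem besselJ_zero_zero : besselJ 0 0 = 1 := by
  rw [besselJ, tsum_eq_single 0 (fun k hk => by simp [hk])]
  simp

/-- The value is `-2i/π`: `J_0(0) = 1`, `regularPartZero` vanishes at `0`, and the `2` in
`regularPartOne` comes from the pole of `Y_1`. -/
theorem besselDet_zero_ne_zero : besselDet 0 ≠ 0 := by
  have hp : (Real.pi : ℂ) ≠ 0 := by exact_mod_cast Real.pi_ne_zero
  simp [besselDet, besselJ_zero_zero, regularPartZero, regularPartOne, hp]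

theorem exists_besselDet_ne_zero (a : ℝ) : ∃ r : ℝ, a < r ∧ besselDet r ≠ 0 := by
  by_contra! hcon
  have h := AnalyticOnNhd.eqOn_zero_of_preconnected_of_frequently_eq_zero (U := univ)
    (z₀ := ((a + 1 : ℝ) : ℂ)) (fun z _ => analyticAt_besselDet z) isPreconnected_univ (mem_univ _)
    (frequently_eq_zero_of_ofReal (lt_add_one a) hcon)
  exact besselDet_zero_ne_zero (h (mem_univ 0))

/-! ### Vanishing of the coefficients -/

theorem coeff_eq_zero_of_tsum_frequently_eq_zero {c : ℕ → ℂ} {R : ℝ} (hR : 0 < R)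
    (hc : Summable fun k => ‖c k‖ * R ^ k) {x : ℂ} (hx : ‖x‖ < R)
    (h : ∃ᶠ z in 𝓝[≠] x, ∑' k, c k * z ^ k = 0) (k : ℕ) : c k = 0 := by
  have hball : EqOn (fun z : ℂ => ∑' k, c k * z ^ k) 0 (Metric.ball 0 R) :=
    AnalyticOnNhd.eqOn_zero_of_preconnected_of_frequently_eq_zero
      (fun z hz => analyticAt_tsum hR hc (by simpa using hz))
      (convex_ball (0 : ℂ) R).isPreconnected (by simpa using hx) h
  have hp := (hasFPowerSeriesOnBall_tsum hR hc).hasFPowerSeriesAt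
  have hz : (FormalMultilinearSeries.ofScalars ℂ c) = 0 :=
    (hp.congr (hball.eventuallyEq_of_mem (Metric.ball_mem_nhds _ hR))).eq_zero
  rw [← FormalMultilinearSeries.coeff_ofScalars (𝕜 := ℂ) (p := c) (n := k), hz]
  rfl

/-- One point `r > r₁` with nonzero determinant suffices: by continuity the determinant can be
cancelled near `r`, so the power series vanishes at points accumulating at `1/r`, inside its disc.
-/
theorem coeff_eq_zero_of_besselDet_mul_eq_zero {c : ℕ → ℂ} {r₁ : ℝ} (hr₁ : 0 < r₁)
    (hc : Summable fun k => ‖c k‖ * r₁⁻¹ ^ k)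
    (h : ∀ r : ℝ, r₁ < r → besselDet r * ∑' k, c k * (r : ℂ)⁻¹ ^ k = 0) (k : ℕ) : c k = 0 := by
  obtain ⟨r, hr, hd⟩ := exists_besselDet_ne_zero r₁
  have hr0 : 0 < r := hr₁.trans hr
  refine coeff_eq_zero_of_tsum_frequently_eq_zero (inv_pos.2 hr₁) hc
    (x := ((r⁻¹ : ℝ) : ℂ)) ?_ ?_ k
  · rw [Complex.norm_real, Real.norm_of_nonneg (inv_pos.2 hr0).le]
    exact inv_strictAnti₀ hr₁ hr
  · have ht : Tendsto (fun s : ℝ => ((s⁻¹ : ℝ) : ℂ)) (𝓝[≠] r) (𝓝[≠] ((r⁻¹ : ℝ) : ℂ)) := by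
      refine tendsto_nhdsWithin_of_tendsto_nhds_of_eventually_within _ ?_ ?_
      · exact (Complex.continuous_ofReal.continuousAt.comp
          (continuousAt_inv₀ hr0.ne')).tendsto.mono_left nhdsWithin_le_nhds
      · filter_upwards [self_mem_nhdsWithin] with s hs
        simpa using hs
    refine ht.frequently (Eventually.frequently ?_)
    have hne : ∀ᶠ s : ℝ in 𝓝 r, besselDet s ≠ 0 :=
      ((analyticAt_besselDet r).continuousAt.comp
        Complex.continuous_ofReal.continuousAt).eventually_ne hd
    filter_upwards [nhdsWithin_le_nhds (Ioi_mem_nhds hr), nhdsWithin_le_nhds hne] with s hs hs'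
    simpa using (mul_eq_zero.1 (h s hs)).resolve_left hs'

theorem analyticAt_tsum_exp_neg {c : ℕ → ℂ} {r₁ : ℝ} (hr₁ : 0 < r₁)
    (hc : Summable fun k => ‖c k‖ * r₁⁻¹ ^ k) {w : ℂ} (hw : Real.log r₁ < w.re) :
    AnalyticAt ℂ (fun w => ∑' k, c k * (Complex.exp w)⁻¹ ^ k) w := by
  refine AnalyticAt.fun_comp (f := fun w => (Complex.exp w)⁻¹)
    (analyticAt_tsum (inv_pos.2 hr₁) hc ?_) ?_
  · rw [norm_inv, Complex.norm_exp]
    exact inv_strictAnti₀ hr₁ ((Real.log_lt_iff_lt_exp hr₁).1 hw)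
  · exact AnalyticAt.inv (by fun_prop) (Complex.exp_ne_zero _)

theorem besselJ_and_regularPart_combination_eq_zero {A B : ℕ → ℂ} {r₁ : ℝ} (hr₁ : 0 < r₁)
    (hA : Summable fun k => ‖A k‖ * r₁⁻¹ ^ k) (hB : Summable fun k => ‖B k‖ * r₁⁻¹ ^ k)
    (h : ∀ r : ℝ, r₁ < r → hankelH 0 r * ∑' j, A j * (r : ℂ)⁻¹ ^ j
      + hankelH 1 r * ∑' j, B j * (r : ℂ)⁻¹ ^ j = 0) {r : ℝ} (hr : r₁ < r) :
    besselJ 0 r * ∑' j, A j * (r : ℂ)⁻¹ ^ j + besselJ 1 r * ∑' j, B j * (r : ℂ)⁻¹ ^ j = 0 ∧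
    regularPartZero r * ∑' j, A j * (r : ℂ)⁻¹ ^ j
      + regularPartOne r * ∑' j, B j * (r : ℂ)⁻¹ ^ j = 0 := by
  have hr0 : 0 < r := hr₁.trans hr
  have hp : (Real.pi : ℂ) ≠ 0 := by exact_mod_cast Real.pi_ne_zero
  set F : ℂ → ℂ := fun z => z * besselJ 0 z * ∑' j, A j * z⁻¹ ^ j
    + z * besselJ 1 z * ∑' j, B j * z⁻¹ ^ j with hF
  set G : ℂ → ℂ := fun z => regularPartZero z * ∑' j, A j * z⁻¹ ^ j
    + regularPartOne z * ∑' j, B j * z⁻¹ ^ j with hG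
  have hexp (f : ℂ → ℂ) (hf : ∀ z, AnalyticAt ℂ f z) (w : ℂ) :
      AnalyticAt ℂ (fun w => f (Complex.exp w)) w :=
    AnalyticAt.fun_comp (hf _) (by fun_prop)
  have key := eq_zero_of_linear_mul_add_eq_zero (a := Real.log r₁)
    (f := fun w => F (Complex.exp w)) (g := fun w => G (Complex.exp w))
    -- From `1 + (2i/π) log(z/2)` at `z = e^t`, where `log(z/2) = t - log 2`.
    (p := 1 - 2 * Complex.I / Real.pi * Real.log 2) (q := 2 * Complex.I / Real.pi)
    (by simp [hp])
    (fun w hw => by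
      have h1 := analyticAt_tsum_exp_neg hr₁ hA hw
      have h2 := analyticAt_tsum_exp_neg hr₁ hB hw
      have h3 := hexp _ (analyticAt_besselJ 0) w
      have h4 := hexp _ (analyticAt_besselJ 1) w
      have h5 : AnalyticAt ℂ Complex.exp w := by fun_prop
      exact ((h5.mul h3).mul h1).add ((h5.mul h4).mul h2))
    (fun w hw => by
      have h1 := analyticAt_tsum_exp_neg hr₁ hA hw
      have h2 := analyticAt_tsum_exp_neg hr₁ hB hw
      have h3 := hexp _ analyticAt_regularPartZero w
      have h4 := hexp _ analyticAt_regularPartOne w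
      exact (h3.mul h1).add (h4.mul h2))
    (Complex.exp_periodic.comp F) (Complex.exp_periodic.comp G)
    (fun t ht => by
      have hlt : r₁ < Real.exp t := (Real.log_lt_iff_lt_exp hr₁).1 ht
      have hs := h _ hlt
      have hlog : Complex.log (((Real.exp t : ℝ) : ℂ) / 2) = t - Real.log 2 := by
        have : ((Real.exp t : ℝ) : ℂ) / 2 = ((Real.exp t / 2 : ℝ) : ℂ) := by push_cast; rfl
        rw [this, ← Complex.ofReal_log (by positivity),
          Real.log_div (Real.exp_ne_zero t) two_ne_zero, Real.log_exp]
        push_cast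
        rfl
      have h0 := mul_hankelH_zero ((Real.exp t : ℝ) : ℂ)
      have h1 := mul_hankelH_one (z := ((Real.exp t : ℝ) : ℂ))
        (by exact_mod_cast Real.exp_ne_zero t)
      rw [hlog] at h0 h1
      simp only [hF, hG, ← Complex.ofReal_exp]
      generalize ((Real.exp t : ℝ) : ℂ) = z at *
      linear_combination z * hs - (∑' j, A j * z⁻¹ ^ j) * h0 - (∑' j, B j * z⁻¹ ^ j) * h1)
    (w := (Real.log r : ℂ)) (by simpa using Real.log_lt_log hr₁ hr)
  have hrexp : Complex.exp (Real.log r : ℂ) = r := by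
    rw [← Complex.ofReal_exp, Real.exp_log hr0]
  rw [hrexp] at key
  obtain ⟨k1, k2⟩ := key
  refine ⟨?_, k2⟩
  have hrc : (r : ℂ) ≠ 0 := by exact_mod_cast hr0.ne'
  refine (mul_eq_zero.1 ?_).resolve_left hrc
  linear_combination k1

theorem lemma1 (A B : ℕ → ℂ) (r₁ : ℝ) (hr₁ : 0 < r₁)
    (hA : ConvergesAbsolutelyAndUniformly A r₁)
    (hB : ConvergesAbsolutelyAndUniformly B r₁)
    (h : ∀ r : ℝ, r₁ ≤ r →
      hankelH 0 (r : ℂ) * ∑' j : ℕ, A j / (r : ℂ) ^ j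
        + hankelH 1 (r : ℂ) * ∑' j : ℕ, B j / (r : ℂ) ^ j = 0) :
    ∀ j : ℕ, A j = 0 ∧ B j = 0 := by
  -- Absolute convergence at the endpoint `r = r₁` controls the power series in `1/r` on the whole
  -- disc of radius `1/r₁`.
  have hsum {C : ℕ → ℂ} (hC : ConvergesAbsolutelyAndUniformly C r₁) :
      Summable fun k => ‖C k‖ * r₁⁻¹ ^ k := by
    refine (hC.1 r₁ le_rfl).congr fun k => ?_
    rw [norm_div, norm_pow, Complex.norm_real, Real.norm_of_nonneg hr₁.le, inv_pow,
      div_eq_mul_inv]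
  have h' : ∀ r : ℝ, r₁ < r → hankelH 0 r * ∑' j, A j * (r : ℂ)⁻¹ ^ j
      + hankelH 1 r * ∑' j, B j * (r : ℂ)⁻¹ ^ j = 0 := fun r hr => by
    simpa only [div_eq_mul_inv, inv_pow] using h r hr.le
  have key := fun r hr =>
    besselJ_and_regularPart_combination_eq_zero hr₁ (hsum hA) (hsum hB) h' (r := r) hr
  refine fun j => ⟨coeff_eq_zero_of_besselDet_mul_eq_zero hr₁ (hsum hA) (fun r hr => ?_) j,
    coeff_eq_zero_of_besselDet_mul_eq_zero hr₁ (hsum hB) (fun r hr => ?_) j⟩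
  -- Cramer's rule: eliminating the other sum leaves the determinant times this one.
  · obtain ⟨k1, k2⟩ := key r hr
    rw [besselDet]
    linear_combination regularPartOne r * k1 - besselJ 1 r * k2
  · obtain ⟨k1, k2⟩ := key r hr
    rw [besselDet]
    linear_combination besselJ 0 r * k2 - regularPartZero r * k1
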